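/- Let $m$ be a square-free positive integer and let $F = \mathbb{Q}(\sqrt{-m}) \subseteq \mathbb{C}$. Then: (1) there exist $r, s \in F$ with $r^2 + s^2 = -1$ and $rs(r^2 - s^2) \neq 0$ if and only if $m \not\equiv 7 \pmod 8$; (2) there exist $t, u \in F$ with $t^2 + u^2 = -2$ and $tu(t^2 - u^2) \neq 0$ if and only if $m \not\equiv 7 \pmod 8$. -/

import Mathlib

/-- The imaginary quadratic field `ℚ(√(-m))`, as the subfield of `ℂ` generated over `ℚ` by
`√(-m) = i √m`. -/
noncomputable def imagQuadField (m : ℕ) : IntermediateField ℚ ℂ :=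
  IntermediateField.adjoin ℚ {Complex.I * ((Real.sqrt (m : ℝ) : ℝ) : ℂ)}

/-- The chosen generator is indeed a square root of `-m`. -/
theorem imagQuadField_gen_sq (m : ℕ) :
    (Complex.I * ((Real.sqrt (m : ℝ) : ℝ) : ℂ)) ^ 2 = -(m : ℂ) := by
  have h : (((Real.sqrt (m : ℝ) : ℝ) : ℂ)) ^ 2 = (m : ℂ) := by
    rw [← Complex.ofReal_pow, Real.sq_sqrt (Nat.cast_nonneg m), Complex.ofReal_natCast]
  rw [mul_pow, Complex.I_sq, h]
  ring

/-!
In any field, a zero of `x² + y² + z² + w²` with `w ≠ 0` exhibits `-1` as a sum of two squares,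
because quotients of sums of two squares are sums of two squares. As `√(-m)² = -m`, this makes `-1`
a sum of two squares in `ℚ(√(-m))` exactly when `m` is a sum of three rational squares.

If `m ≡ 7 [MOD 8]`, an equation `x² + y² + z² = m t²` gives `8 ∣ x² + y² + z² + t²`, so all the
variables are even, and descent applies. For the other `m` not divisible by `4`, Dirichlet's theorem
and quadratic reciprocity provide a prime `p ≡ 1 [MOD 4]` such that, for `N = p` or `N = 2p`, `-N`
is a square modulo `m` and `m` is a square modulo `N`. Legendre's theorem then solves
`x² + N w² = m t²`, and `N w²` is a sum of two squares.
-/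

section SumsOfSquaresInFields

variable {K : Type*} [Field K]

theorem exists_sq_add_sq_eq_two_mul_iff (h2 : (2 : K) ≠ 0) {c : K} :
    (∃ t u : K, t ^ 2 + u ^ 2 = 2 * c) ↔ ∃ r s : K, r ^ 2 + s ^ 2 = c := by
  constructor
  · rintro ⟨t, u, h⟩
    refine ⟨(t + u) / 2, (t - u) / 2, ?_⟩
    field_simp
    linear_combination 2 * h
  · rintro ⟨r, s, h⟩
    exact ⟨r + s, r - s, by linear_combination 2 * h⟩

/-- `4 r s (r² - s²)` is the imaginary part of `(r + i s)⁴`; multiplying `r + i s` by the number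
`(3 + 4 i) / 5` of norm one makes it nonzero if it was zero. -/
theorem exists_sq_add_sq_eq_and_ne_zero_iff [CharZero K] {c : K} (hc : c ≠ 0) :
    (∃ r s : K, r ^ 2 + s ^ 2 = c ∧ r * s * (r ^ 2 - s ^ 2) ≠ 0) ↔
      ∃ r s : K, r ^ 2 + s ^ 2 = c := by
  refine ⟨fun ⟨r, s, h, _⟩ ↦ ⟨r, s, h⟩, fun ⟨r, s, h⟩ ↦ ?_⟩
  by_cases h0 : r * s * (r ^ 2 - s ^ 2) = 0
  · have hrot : (3 * r - 4 * s) / 5 * ((4 * r + 3 * s) / 5) *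
        (((3 * r - 4 * s) / 5) ^ 2 - ((4 * r + 3 * s) / 5) ^ 2) =
          84 / 625 * (8 * (r * s) ^ 2 - c ^ 2) := by
      linear_combination (-527 / 625) * h0 - 84 / 625 * (r ^ 2 + s ^ 2 + c) * h
    have hval : 8 * (r * s) ^ 2 - c ^ 2 = -c ^ 2 ∨ 8 * (r * s) ^ 2 - c ^ 2 = c ^ 2 := by
      rcases mul_eq_zero.mp h0 with hrs | hrs
      · left
        linear_combination 8 * (r * s) * hrs
      · right
        linear_combination 2 * (r ^ 2 + s ^ 2 + c) * h - 2 * (r ^ 2 - s ^ 2) * hrs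
    refine ⟨(3 * r - 4 * s) / 5, (4 * r + 3 * s) / 5, by linear_combination h, ?_⟩
    rw [hrot]
    rcases hval with hval | hval <;> simp [hval, hc]
  · exact ⟨r, s, h, h0⟩

theorem exists_sq_add_sq_eq_neg_one_of_four_squares {x y z w : K} (hw : w ≠ 0)
    (h : x ^ 2 + y ^ 2 + z ^ 2 + w ^ 2 = 0) : ∃ r s : K, r ^ 2 + s ^ 2 = -1 := by
  by_cases hzw : z ^ 2 + w ^ 2 = 0
  · refine ⟨z / w, 0, ?_⟩
    field_simp
    linear_combination hzw
  · refine ⟨(x * z + y * w) / (z ^ 2 + w ^ 2), (x * w - y * z) / (z ^ 2 + w ^ 2), ?_⟩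
    field_simp
    linear_combination (z ^ 2 + w ^ 2) * h

theorem exists_three_squares_of_sq_add_sq_eq_neg_one (h2 : (2 : K) ≠ 0)
    (h : ∃ r s : K, r ^ 2 + s ^ 2 = -1) (d : K) : ∃ x y z : K, x ^ 2 + y ^ 2 + z ^ 2 = d := by
  obtain ⟨r, s, h⟩ := h
  -- `d = ((d + 1) / 2)² - ((d - 1) / 2)²`
  refine ⟨(d + 1) / 2, r * ((d - 1) / 2), s * ((d - 1) / 2), ?_⟩
  field_simp
  linear_combination (d - 1) ^ 2 * h

theorem exists_three_squares_of_orthogonal (h2 : (2 : K) ≠ 0) {a b c e d : K}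
    (horth : a * b + c * e = 0) (hnorm : a ^ 2 + c ^ 2 + 1 = d * (b ^ 2 + e ^ 2)) :
    ∃ x y z : K, x ^ 2 + y ^ 2 + z ^ 2 = d := by
  by_cases hbe : b ^ 2 + e ^ 2 = 0
  · exact exists_three_squares_of_sq_add_sq_eq_neg_one h2
      ⟨a, c, by linear_combination hnorm + d * hbe⟩ d
  · refine ⟨b / (b ^ 2 + e ^ 2), e / (b ^ 2 + e ^ 2), (a * e - b * c) / (b ^ 2 + e ^ 2), ?_⟩
    field_simp
    linear_combination (b ^ 2 + e ^ 2) * hnorm - (a * b + c * e) * horth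

end SumsOfSquaresInFields

section QuadraticExtension

open IntermediateField

variable {F E : Type*} [Field F] [Field E] [Algebra F E] {ω : E} {d : F}

theorem exists_eq_add_mul_of_mem_adjoin_simple (hω : ω ^ 2 = algebraMap F E d) {z : E}
    (hz : z ∈ F⟮ω⟯) : ∃ a b : F, z = algebraMap F E a + algebraMap F E b * ω := by
  have halg : IsAlgebraic F ω :=
    .of_pow two_pos (hω ▸ isAlgebraic_algebraMap d)
  rw [← mem_toSubalgebra, adjoin_simple_toSubalgebra_of_isAlgebraic halg] at hz
  induction hz using Algebra.adjoin_induction with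
  | mem x hx => exact ⟨0, 1, by simpa using hx⟩
  | algebraMap x => exact ⟨x, 0, by simp⟩
  | add x y hx hy ihx ihy =>
    obtain ⟨a, b, rfl⟩ := ihx
    obtain ⟨a', b', rfl⟩ := ihy
    exact ⟨a + a', b + b', by simp only [map_add]; ring⟩
  | mul x y hx hy ihx ihy =>
    obtain ⟨a, b, rfl⟩ := ihx
    obtain ⟨a', b', rfl⟩ := ihy
    refine ⟨a * a' + d * (b * b'), a * b' + b * a', ?_⟩
    simp only [map_add, map_mul]
    linear_combination algebraMap F E b * algebraMap F E b' * hω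

theorem eq_zero_of_add_mul_eq_zero (hωF : ω ∉ Set.range (algebraMap F E)) {a b : F}
    (h : algebraMap F E a + algebraMap F E b * ω = 0) : a = 0 ∧ b = 0 := by
  have hb : b = 0 := by
    by_contra hb
    have hbE : algebraMap F E b ≠ 0 := by simpa using hb
    refine hωF ⟨-a / b, ?_⟩
    rw [map_div₀, map_neg, div_eq_iff hbE]
    linear_combination -h
  exact ⟨by simpa [hb] using h, hb⟩

theorem exists_sq_add_sq_eq_neg_one_adjoin_iff (h2 : (2 : F) ≠ 0)
    (hω : ω ^ 2 = -algebraMap F E d) (hωF : ω ∉ Set.range (algebraMap F E)) :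
    (∃ r s : F⟮ω⟯, r ^ 2 + s ^ 2 = -1) ↔ ∃ x y z : F, x ^ 2 + y ^ 2 + z ^ 2 = d := by
  constructor
  · rintro ⟨⟨r, hr⟩, ⟨s, hs⟩, h⟩
    have hω' : ω ^ 2 = algebraMap F E (-d) := by rw [hω, map_neg]
    obtain ⟨a, b, rfl⟩ := exists_eq_add_mul_of_mem_adjoin_simple hω' hr
    obtain ⟨c, e, rfl⟩ := exists_eq_add_mul_of_mem_adjoin_simple hω' hs
    have hE : (algebraMap F E a + algebraMap F E b * ω) ^ 2 +
        (algebraMap F E c + algebraMap F E e * ω) ^ 2 = -1 := congrArg Subtype.val h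
    obtain ⟨hnorm, horth⟩ := eq_zero_of_add_mul_eq_zero hωF
      (a := a ^ 2 + c ^ 2 + 1 - d * (b ^ 2 + e ^ 2)) (b := 2 * (a * b + c * e)) (by
        simp only [map_add, map_sub, map_mul, map_pow, map_one, map_ofNat]
        linear_combination hE - (algebraMap F E b ^ 2 + algebraMap F E e ^ 2) * hω)
    exact exists_three_squares_of_orthogonal h2 ((mul_eq_zero.mp horth).resolve_left h2)
      (sub_eq_zero.mp hnorm)
  · rintro ⟨x, y, z, h⟩
    have hgen : AdjoinSimple.gen F ω ^ 2 = -algebraMap F F⟮ω⟯ d :=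
      Subtype.ext (by simpa using hω)
    have hgen0 : AdjoinSimple.gen F ω ≠ 0 := fun h0 ↦
      hωF ⟨0, by simpa using (congrArg Subtype.val h0).symm⟩
    refine exists_sq_add_sq_eq_neg_one_of_four_squares (x := algebraMap F F⟮ω⟯ x)
      (y := algebraMap F F⟮ω⟯ y) (z := algebraMap F F⟮ω⟯ z) hgen0 ?_
    rw [hgen, ← h]
    simp only [map_add, map_pow]
    ring

end QuadraticExtension

section SevenModEight

theorem even_of_eight_dvd_four_squares {x y z t : ℤ}
    (h : 8 ∣ x ^ 2 + y ^ 2 + z ^ 2 + t ^ 2) : Even x ∧ Even y ∧ Even z ∧ Even t := by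
  have sq_residue (a : ℤ) : Even a ∧ 4 ∣ a ^ 2 ∨ Odd a ∧ 8 ∣ a ^ 2 - 1 :=
    (Int.even_or_odd a).imp (fun h ↦ ⟨h, pow_dvd_pow_of_dvd h.two_dvd 2⟩)
      fun h ↦ ⟨h, Int.eight_dvd_sq_sub_one_of_odd h⟩
  rcases sq_residue x with ⟨hx, hx'⟩ | ⟨-, hx'⟩ <;>
    rcases sq_residue y with ⟨hy, hy'⟩ | ⟨-, hy'⟩ <;>
    rcases sq_residue z with ⟨hz, hz'⟩ | ⟨-, hz'⟩ <;>
    rcases sq_residue t with ⟨ht, ht'⟩ | ⟨-, ht'⟩ <;>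
    first | exact ⟨hx, hy, hz, ht⟩ | omega

theorem eq_zero_of_three_squares_eq_mul_sq {m : ℤ} (hm : m ≡ 7 [ZMOD 8]) {x y z t : ℤ}
    (h : x ^ 2 + y ^ 2 + z ^ 2 = m * t ^ 2) : t = 0 := by
  induction hn : t.natAbs using Nat.strong_induction_on generalizing x y z t with
  | _ n ih =>
  have h8 : (8 : ℤ) ∣ x ^ 2 + y ^ 2 + z ^ 2 + t ^ 2 := by
    obtain ⟨k, hk⟩ := hm.symm.dvd
    exact ⟨(k + 1) * t ^ 2, by linear_combination h + t ^ 2 * hk⟩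
  obtain ⟨⟨x, rfl⟩, ⟨y, rfl⟩, ⟨z, rfl⟩, ⟨t, rfl⟩⟩ := even_of_eight_dvd_four_squares h8
  by_contra ht
  have : t = 0 := ih t.natAbs (by omega) (by linarith : x ^ 2 + y ^ 2 + z ^ 2 = m * t ^ 2) rfl
  omega

theorem not_exists_rat_three_squares {m : ℤ} (hm : m ≡ 7 [ZMOD 8]) :
    ¬ ∃ x y z : ℚ, x ^ 2 + y ^ 2 + z ^ 2 = m := by
  rintro ⟨x, y, z, h⟩
  obtain ⟨t, ht⟩ := IsLocalization.exist_integer_multiples_of_finset (nonZeroDivisors ℤ) {x, y, z}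
  simp only [Finset.mem_insert, Finset.mem_singleton, forall_eq_or_imp, forall_eq] at ht
  obtain ⟨⟨x', hx⟩, ⟨y', hy⟩, ⟨z', hz⟩⟩ := ht
  rw [zsmul_eq_mul, eq_intCast] at hx hy hz
  have hint : x' ^ 2 + y' ^ 2 + z' ^ 2 = m * (t : ℤ) ^ 2 := by
    have : (x' ^ 2 + y' ^ 2 + z' ^ 2 : ℚ) = m * (t : ℤ) ^ 2 := by
      rw [hx, hy, hz]
      linear_combination (t : ℚ) ^ 2 * h
    exact_mod_cast this
  exact nonZeroDivisors.coe_ne_zero t (eq_zero_of_three_squares_eq_mul_sq hm hint)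

end SevenModEight

section Legendre

theorem exists_ne_zero_abs_le_map_eq_zero {ι A : Type*} [Fintype ι] [AddCommGroup A] [Finite A]
    (φ : (ι → ℤ) →+ A) (b : ι → ℕ) (h : Nat.card A < ∏ i, (b i + 1)) :
    ∃ v : ι → ℤ, v ≠ 0 ∧ (∀ i, |v i| ≤ b i) ∧ φ v = 0 := by
  classical
  have := Fintype.ofFinite A
  have hcard : (Finset.univ : Finset A).card < (Finset.Icc 0 (fun i ↦ (b i : ℤ))).card := by
    simpa [Pi.card_Icc, Nat.card_eq_fintype_card] using h
  obtain ⟨v, hv, w, hw, hne, heq⟩ :=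
    Finset.exists_ne_map_eq_of_card_lt_of_maps_to hcard (f := φ) (by simp)
  rw [Finset.mem_Icc] at hv hw
  refine ⟨v - w, sub_ne_zero.mpr hne, fun i ↦ ?_, by rw [map_sub, heq, sub_self]⟩
  exact abs_sub_le_of_nonneg_of_le (hv.1 i) (hv.2 i) (hw.1 i) (hw.2 i)

variable {m N : ℕ}

theorem sq_le_of_abs_le_sqrt {a : ℤ} {k : ℕ} (h : |a| ≤ k.sqrt) : a ^ 2 ≤ k :=
  (sq_le_sq.mpr (h.trans_eq (abs_of_nonneg (Int.natCast_nonneg _)).symm)).trans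
    (mod_cast Nat.sqrt_le' k)

/-- The pigeonhole principle applies because `√(mN) √m √N = mN`. -/
theorem exists_small_dvd_sq_add_mul_sq_sub_mul_sq [NeZero m] [NeZero N]
    (hmN : m.Coprime N) (hm : IsSquare (m : ZMod N)) (hN : IsSquare (-N : ZMod m)) :
    ∃ x w t : ℤ, ¬ (x = 0 ∧ w = 0 ∧ t = 0) ∧ x ^ 2 ≤ m * N ∧ w ^ 2 ≤ m ∧ t ^ 2 ≤ N ∧
      (m * N : ℤ) ∣ x ^ 2 + N * w ^ 2 - m * t ^ 2 := by
  obtain ⟨c, hc⟩ := hm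
  obtain ⟨d, hd⟩ := hN
  let φ : (Fin 3 → ℤ) →+ ZMod m × ZMod N :=
    .mk' (fun v ↦ (v 0 - d * v 1, v 0 - c * v 2)) fun v w ↦ by
      ext <;> simp only [Pi.add_apply, Int.cast_add, Prod.mk_add_mk] <;> ring
  let b : Fin 3 → ℕ := ![(m * N).sqrt, m.sqrt, N.sqrt]
  have hcard : Nat.card (ZMod m × ZMod N) < ∏ i, (b i + 1) := by
    simp only [Nat.card_prod, Nat.card_zmod, Fin.prod_univ_three, b, Matrix.cons_val]
    refine lt_of_pow_lt_pow_left₀ 2 (Nat.zero_le _) ?_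
    calc (m * N) ^ 2 = m * N * (m * N) := sq _
      _ < ((m * N).sqrt + 1) ^ 2 * ((m.sqrt + 1) ^ 2 * (N.sqrt + 1) ^ 2) := by
        gcongr <;> exact Nat.lt_succ_sqrt' _
      _ = _ := by ring
  obtain ⟨v, hv0, hvb, hv⟩ := exists_ne_zero_abs_le_map_eq_zero φ b hcard
  obtain ⟨hvm, hvN⟩ := Prod.ext_iff.mp hv
  have hdvd_m : (m : ℤ) ∣ v 0 ^ 2 + N * v 1 ^ 2 - m * v 2 ^ 2 := by
    rw [← ZMod.intCast_zmod_eq_zero_iff_dvd]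
    push_cast
    simp only [φ, AddMonoidHom.mk'_apply, Prod.fst_zero] at hvm
    linear_combination (v 0 + d * v 1 : ZMod m) * hvm - (v 1 : ZMod m) ^ 2 * hd
      - (v 2 : ZMod m) ^ 2 * ZMod.natCast_self m
  have hdvd_N : (N : ℤ) ∣ v 0 ^ 2 + N * v 1 ^ 2 - m * v 2 ^ 2 := by
    rw [← ZMod.intCast_zmod_eq_zero_iff_dvd]
    push_cast
    simp only [φ, AddMonoidHom.mk'_apply, Prod.snd_zero] at hvN
    linear_combination (v 0 + c * v 2 : ZMod N) * hvN - (v 2 : ZMod N) ^ 2 * hc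
      + (v 1 : ZMod N) ^ 2 * ZMod.natCast_self N
  refine ⟨v 0, v 1, v 2, fun ⟨h0, h1, h2⟩ ↦ hv0 ?_, ?_, sq_le_of_abs_le_sqrt (hvb 1),
    sq_le_of_abs_le_sqrt (hvb 2), (Nat.isCoprime_iff_coprime.mpr hmN).mul_dvd hdvd_m hdvd_N⟩
  · ext i
    fin_cases i <;> assumption
  · exact_mod_cast sq_le_of_abs_le_sqrt (hvb 0)

theorem sq_ne_natCast_of_not_isSquare {k : ℕ} (hk : ¬ IsSquare k) (a : ℤ) : a ^ 2 ≠ k := by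
  intro h
  refine hk ⟨a.natAbs, ?_⟩
  zify
  rw [abs_mul_abs_self, ← sq, h]

theorem exists_sq_add_mul_sq_eq_mul_sq_or (hm_sq : ¬ IsSquare m) (hN_sq : ¬ IsSquare N)
    (hmN : m.Coprime N) (hm : IsSquare (m : ZMod N)) (hN : IsSquare (-N : ZMod m)) :
    ∃ x w t : ℤ, ¬ (x = 0 ∧ w = 0 ∧ t = 0) ∧
      (x ^ 2 + N * w ^ 2 = m * t ^ 2 ∨ x ^ 2 + N * w ^ 2 = m * t ^ 2 + m * N) := by
  have : NeZero m := ⟨fun h ↦ hm_sq (h ▸ .zero)⟩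
  have : NeZero N := ⟨fun h ↦ hN_sq (h ▸ .zero)⟩
  obtain ⟨x, w, t, hne, hx, hw, ht, k, hk⟩ :=
    exists_small_dvd_sq_add_mul_sq_sub_mul_sq hmN hm hN
  have hm_pos : (0 : ℤ) < m := mod_cast NeZero.pos m
  have hN_pos : (0 : ℤ) < N := mod_cast NeZero.pos N
  have hmN_pos : (0 : ℤ) < m * N := mul_pos hm_pos hN_pos
  have hw' : (N : ℤ) * w ^ 2 < m * N := by
    rw [mul_comm (m : ℤ)]
    exact mul_lt_mul_of_pos_left (hw.lt_of_ne (sq_ne_natCast_of_not_isSquare hm_sq w)) hN_pos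
  have ht' : (m : ℤ) * t ^ 2 < m * N :=
    mul_lt_mul_of_pos_left (ht.lt_of_ne (sq_ne_natCast_of_not_isSquare hN_sq t)) hm_pos
  have hx0 := sq_nonneg x
  have hw0 : 0 ≤ (N : ℤ) * w ^ 2 := by positivity
  have ht0 : 0 ≤ (m : ℤ) * t ^ 2 := by positivity
  have hk_lower : -1 < k := lt_of_mul_lt_mul_left (by linarith) hmN_pos.le
  have hk_upper : k < 2 := lt_of_mul_lt_mul_left (by linarith) hmN_pos.le
  refine ⟨x, w, t, hne, ?_⟩
  obtain rfl | rfl : k = 0 ∨ k = 1 := by omega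
  · exact .inl (by linarith)
  · exact .inr (by linarith)

theorem exists_sq_add_mul_sq_eq_mul_sq_of_not_isSquare (hm_sq : ¬ IsSquare m)
    (hN_sq : ¬ IsSquare N) (hmN : m.Coprime N) (hm : IsSquare (m : ZMod N))
    (hN : IsSquare (-N : ZMod m)) :
    ∃ x w t : ℤ, t ≠ 0 ∧ x ^ 2 + N * w ^ 2 = m * t ^ 2 := by
  have hN_pos : (0 : ℤ) < N := by
    have hN0 : N ≠ 0 := fun h ↦ hN_sq (h ▸ .zero)
    positivity
  obtain ⟨x, w, t, hne, h | h⟩ := exists_sq_add_mul_sq_eq_mul_sq_or hm_sq hN_sq hmN hm hN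
  · refine ⟨x, w, t, ?_, h⟩
    rintro rfl
    have hw : w = 0 := by
      by_contra hw
      have : 0 < x ^ 2 + N * w ^ 2 := by positivity
      linarith
    subst hw
    exact hne ⟨by simpa using h, rfl, rfl⟩
  · -- Multiply `x² - m t² = -N (w² - m)` by `w² - m`; norms from `ℤ[√m]` are multiplicative.
    have hmul : (x * w + m * t) ^ 2 + N * (w ^ 2 - m) ^ 2 = m * (x + t * w) ^ 2 := by
      linear_combination (w ^ 2 - m : ℤ) * h
    refine ⟨x * w + m * t, w ^ 2 - m, x + t * w, fun h0 ↦ ?_, hmul⟩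
    have hw : w ^ 2 - (m : ℤ) ≠ 0 := sub_ne_zero.mpr (sq_ne_natCast_of_not_isSquare hm_sq w)
    have : 0 < (x * w + m * t) ^ 2 + N * (w ^ 2 - m) ^ 2 := by positivity
    simp [hmul, h0] at this

/-- A case of Legendre's theorem on ternary quadratic forms. -/
theorem exists_sq_add_mul_sq_eq_mul_sq (hmN : m.Coprime N) (hm : IsSquare (m : ZMod N))
    (hN : IsSquare (-N : ZMod m)) : ∃ x w t : ℤ, t ≠ 0 ∧ x ^ 2 + N * w ^ 2 = m * t ^ 2 := by
  by_cases hm_sq : IsSquare m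
  · obtain ⟨a, rfl⟩ := hm_sq
    exact ⟨a, 0, 1, one_ne_zero, by push_cast; ring⟩
  by_cases hN_sq : IsSquare N
  · obtain ⟨n, rfl⟩ := hN_sq
    have hn : n ≠ 0 := by
      rintro rfl
      simp_all
    obtain ⟨u, hu⟩ := (ZMod.isUnit_iff_coprime n m).mpr hmN.coprime_mul_right_right.symm
    have hneg : IsSquare (-1 : ZMod m) := by
      have hinv : -((n * n : ℕ) : ZMod m) * (↑u⁻¹ * ↑u⁻¹) = -1 := by
        rw [Nat.cast_mul, ← hu]
        linear_combination (-u * ↑u⁻¹ - 1 : ZMod m) * u.mul_inv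
      exact hinv ▸ hN.mul (.mul_self _)
    obtain ⟨a, b, hab⟩ := Nat.eq_sq_add_sq_of_isSquare_mod_neg_one hneg
    exact ⟨n * a, b, n, by exact_mod_cast hn, by rw [hab]; push_cast; ring⟩
  · exact exists_sq_add_mul_sq_eq_mul_sq_of_not_isSquare hm_sq hN_sq hmN hm hN

end Legendre

section QuadraticReciprocity

open NumberTheorySymbols

theorem exists_prime_cast_eq_and_cast_eq {M k : ℕ} [NeZero M] [NeZero k] (h : M.Coprime k)
    (u : (ZMod M)ˣ) (v : (ZMod k)ˣ) :
    ∃ p : ℕ, p.Prime ∧ (p : ZMod M) = u ∧ (p : ZMod k) = v := by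
  have : NeZero (M * k) := ⟨mul_ne_zero (NeZero.ne M) (NeZero.ne k)⟩
  let w : (ZMod (M * k))ˣ :=
    Units.map (ZMod.chineseRemainder h).symm.toMonoidHom (MulEquiv.prodUnits.symm (u, v))
  obtain ⟨p, -, hp, hpw⟩ := Nat.forall_exists_prime_gt_and_eq_mod w.isUnit 0
  have hcrt : ((p : ZMod M), (p : ZMod k)) = (↑u, ↑v) :=
    calc ((p : ZMod M), (p : ZMod k)) = ZMod.chineseRemainder h p := (map_natCast _ p).symm
      _ = (↑u, ↑v) := by rw [hpw]; exact (ZMod.chineseRemainder h).apply_symm_apply _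
  exact ⟨p, hp, congrArg Prod.fst hcrt, congrArg Prod.snd hcrt⟩

theorem exists_prime_mod_eight_eq_and_cast_eq {k e : ℕ} (hk : Odd k) (he : Odd e)
    (v : (ZMod k)ˣ) : ∃ p : ℕ, p.Prime ∧ p ≡ e [MOD 8] ∧ (p : ZMod k) = v := by
  have : NeZero k := ⟨hk.pos.ne'⟩
  have odd_coprime {n : ℕ} (hn : Odd n) : n.Coprime 8 :=
    (Nat.coprime_two_right.mpr hn).pow_right 3
  obtain ⟨p, hp, hpe, hpv⟩ := exists_prime_cast_eq_and_cast_eq (odd_coprime hk).symm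
    (ZMod.unitOfCoprime e (odd_coprime he)) v
  exact ⟨p, hp, (ZMod.natCast_eq_natCast_iff _ _ _).mp hpe, hpv⟩

theorem jacobiSym_eq_of_cast_eq {a b : ℤ} {n : ℕ} (h : (a : ZMod n) = b) : J(a | n) = J(b | n) :=
  jacobiSym.mod_left' ((ZMod.intCast_eq_intCast_iff' a b n).mp h)

theorem jacobiSym_eq_χ₄_of_cast_eq_neg_one {p k : ℕ} (hk : Odd k) (hp : p % 4 = 1)
    (h : (p : ZMod k) = -1) : J(k | p) = ZMod.χ₄ k := by
  rw [jacobiSym.quadratic_reciprocity_one_mod_four' hk hp,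
    jacobiSym_eq_of_cast_eq (b := -1) (by simpa using h), jacobiSym.at_neg_one hk]

theorem exists_prime_of_mod_four_eq_one {m : ℕ} (hm : m % 4 = 1) :
    ∃ p : ℕ, p.Prime ∧ p % 4 = 1 ∧ m ∣ p + 1 ∧ IsSquare (m : ZMod p) := by
  have hodd : Odd m := Nat.odd_iff.mpr (by omega)
  obtain ⟨p, hp, hp8, hpm⟩ := exists_prime_mod_eight_eq_and_cast_eq hodd odd_one (-1)
  have hp4 : p % 4 = 1 := Nat.ModEq.of_mul_left (n := 4) 2 hp8
  have hpm' : (p : ZMod m) = -1 := by simpa using hpm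
  have : Fact p.Prime := ⟨hp⟩
  have hJ : J(m | p) = 1 := by
    rw [jacobiSym_eq_χ₄_of_cast_eq_neg_one hodd hp4 hpm', ZMod.χ₄_nat_one_mod_four hm]
  refine ⟨p, hp, hp4, ?_, mod_cast ZMod.isSquare_of_jacobiSym_eq_one hJ⟩
  rw [← ZMod.natCast_eq_zero_iff]
  simp [hpm']

theorem exists_prime_of_mod_four_eq_two {m : ℕ} (hm : m % 4 = 2) :
    ∃ p : ℕ, p.Prime ∧ p % 4 = 1 ∧ m ∣ p + 1 ∧ IsSquare (m : ZMod p) := by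
  obtain ⟨k, rfl⟩ : 2 ∣ m := by omega
  have hodd : Odd k := Nat.odd_iff.mpr (by omega)
  -- `2 k - 1` is `1` or `5` modulo `8`, according as `χ₄ k` is `1` or `-1`, so `χ₈ p = χ₄ k`.
  obtain ⟨p, hp, hp8, hpk⟩ := exists_prime_mod_eight_eq_and_cast_eq hodd
    (e := 2 * k - 1) (Nat.odd_iff.mpr (by omega)) (-1)
  rw [Nat.ModEq] at hp8
  have hp4 : p % 4 = 1 := by omega
  have hpk' : (p : ZMod k) = -1 := by simpa using hpk
  have : Fact p.Prime := ⟨hp⟩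
  have hχ : ZMod.χ₈ p * ZMod.χ₄ k = 1 := by
    obtain hk | hk : k % 4 = 1 ∨ k % 4 = 3 := by omega
    · rw [ZMod.χ₈_nat_mod_eight, show p % 8 = 1 by omega, ZMod.χ₄_nat_one_mod_four hk]
      rfl
    · rw [ZMod.χ₈_nat_mod_eight, show p % 8 = 5 by omega, ZMod.χ₄_nat_three_mod_four hk]
      rfl
  have hJ : J((2 * k : ℕ) | p) = 1 := by
    rw [Nat.cast_mul, jacobiSym.mul_left, jacobiSym_eq_χ₄_of_cast_eq_neg_one hodd hp4 hpk',
      Nat.cast_ofNat, jacobiSym.at_two (Nat.odd_iff.mpr (by omega)), hχ]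
  refine ⟨p, hp, hp4, ?_, mod_cast ZMod.isSquare_of_jacobiSym_eq_one hJ⟩
  refine (Nat.coprime_two_left.mpr hodd).mul_dvd_of_dvd_of_dvd (by omega) ?_
  rw [← ZMod.natCast_eq_zero_iff]
  simp [hpk']

theorem exists_prime_of_mod_eight_eq_three {m : ℕ} (hm : m % 8 = 3) :
    ∃ p : ℕ, p.Prime ∧ p % 4 = 1 ∧ m ∣ 2 * p + 1 ∧ IsSquare (m : ZMod p) := by
  have hodd : Odd m := Nat.odd_iff.mpr (by omega)
  let two : (ZMod m)ˣ := ZMod.unitOfCoprime 2 (Nat.coprime_two_left.mpr hodd)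
  obtain ⟨p, hp, hp8, hpm⟩ := exists_prime_mod_eight_eq_and_cast_eq hodd odd_one (-two⁻¹)
  have hp4 : p % 4 = 1 := Nat.ModEq.of_mul_left (n := 4) 2 hp8
  have hpm' : (2 * p : ZMod m) = -1 := by
    have htwo : (2 : ZMod m) = two := by simp [two]
    rw [htwo, hpm]
    simp
  have : Fact p.Prime := ⟨hp⟩
  have hJ : J(m | p) = 1 := by
    have hneg_two : J(-2 | m) = 1 := by
      rw [jacobiSym.at_neg_two hodd, ZMod.χ₈'_nat_eq_if_mod_eight, if_neg (by omega),
        if_pos (.inr hm)]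
    calc J(m | p) = J(p | m) := jacobiSym.quadratic_reciprocity_one_mod_four' hodd hp4
      _ = J(-2 * p | m) := by rw [jacobiSym.mul_left, hneg_two, one_mul]
      _ = J(1 | m) := jacobiSym_eq_of_cast_eq (by push_cast; linear_combination -hpm')
      _ = 1 := jacobiSym.one_left m
  refine ⟨p, hp, hp4, ?_, mod_cast ZMod.isSquare_of_jacobiSym_eq_one hJ⟩
  rw [← ZMod.natCast_eq_zero_iff]
  simp [hpm']

theorem isSquare_natCast_zmod_mul {a M N : ℕ} (h : M.Coprime N) (hM : IsSquare (a : ZMod M))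
    (hN : IsSquare (a : ZMod N)) : IsSquare (a : ZMod (M * N)) := by
  obtain ⟨c, hc⟩ := hM
  obtain ⟨d, hd⟩ := hN
  have hprod : IsSquare (a : ZMod M × ZMod N) := ⟨(c, d), Prod.ext hc hd⟩
  simpa using hprod.map (ZMod.chineseRemainder h).symm

theorem exists_sq_add_sq_dvd_add_one {m : ℕ} (hm4 : ¬ 4 ∣ m) (hm7 : ¬ m ≡ 7 [MOD 8]) :
    ∃ a b : ℕ, m ∣ a ^ 2 + b ^ 2 + 1 ∧ IsSquare (m : ZMod (a ^ 2 + b ^ 2)) := by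
  have sum_two_squares {p : ℕ} (hp : p.Prime) (hp4 : p % 4 = 1) : ∃ a b : ℕ, a ^ 2 + b ^ 2 = p :=
    have : Fact p.Prime := ⟨hp⟩
    Nat.Prime.sq_add_sq (by omega)
  by_cases hm3 : m % 8 = 3
  · obtain ⟨p, hp, hp4, hdvd, hsq⟩ := exists_prime_of_mod_eight_eq_three hm3
    obtain ⟨a, b, hab⟩ := sum_two_squares hp hp4
    obtain ⟨u, v, huv⟩ := Nat.sq_add_sq_mul (a := 2) (x := 1) (y := 1) rfl hab.symm
    have hcop : Nat.Coprime 2 p := Nat.coprime_two_left.mpr (Nat.odd_iff.mpr (by omega))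
    refine ⟨u, v, ?_, ?_⟩ <;> rw [← huv]
    · exact hdvd
    · exact isSquare_natCast_zmod_mul hcop
        (FiniteField.isSquare_of_char_two (ZMod.ringChar_zmod_n 2) _) hsq
  · obtain ⟨p, hp, hp4, hdvd, hsq⟩ :
        ∃ p : ℕ, p.Prime ∧ p % 4 = 1 ∧ m ∣ p + 1 ∧ IsSquare (m : ZMod p) := by
      rw [Nat.ModEq] at hm7
      obtain h | h : m % 4 = 1 ∨ m % 4 = 2 := by omega
      · exact exists_prime_of_mod_four_eq_one h
      · exact exists_prime_of_mod_four_eq_two h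
    obtain ⟨a, b, rfl⟩ := sum_two_squares hp hp4
    exact ⟨a, b, hdvd, hsq⟩

end QuadraticReciprocity

theorem exists_rat_three_squares_iff {m : ℕ} (hm : ¬ 4 ∣ m) :
    (∃ x y z : ℚ, x ^ 2 + y ^ 2 + z ^ 2 = m) ↔ ¬ m ≡ 7 [MOD 8] := by
  refine ⟨fun h hm7 ↦ not_exists_rat_three_squares (Int.natCast_modEq_iff.mpr hm7) h, fun hm7 ↦ ?_⟩
  obtain ⟨a, b, hdvd, hsq⟩ := exists_sq_add_sq_dvd_add_one hm hm7
  have hcop : m.Coprime (a ^ 2 + b ^ 2) :=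
    Nat.Coprime.of_dvd_left hdvd (Nat.coprime_self_add_left.mpr (Nat.coprime_one_left _))
  have hneg : IsSquare (-(a ^ 2 + b ^ 2 : ℕ) : ZMod m) := by
    have : ((a ^ 2 + b ^ 2 + 1 : ℕ) : ZMod m) = 0 := (ZMod.natCast_eq_zero_iff _ _).mpr hdvd
    exact ⟨1, by push_cast at this ⊢; linear_combination -this⟩
  obtain ⟨x, w, t, ht, h⟩ := exists_sq_add_mul_sq_eq_mul_sq hcop hsq hneg
  have htQ : (t : ℚ) ≠ 0 := mod_cast ht
  have hQ : (x ^ 2 + (a ^ 2 + b ^ 2) * w ^ 2 : ℚ) = m * t ^ 2 := mod_cast h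
  refine ⟨x / t, a * w / t, b * w / t, ?_⟩
  field_simp
  linear_combination hQ

theorem I_mul_sqrt_notMem_range_algebraMap {m : ℕ} (hm : m ≠ 0) :
    Complex.I * ((Real.sqrt (m : ℝ) : ℝ) : ℂ) ∉ Set.range (algebraMap ℚ ℂ) := by
  rintro ⟨q, hq⟩
  have hsq : (q : ℂ) ^ 2 = -(m : ℂ) := by rw [← imagQuadField_gen_sq m, ← hq, eq_ratCast]
  have hsqQ : q ^ 2 = -(m : ℚ) := mod_cast hsq
  have : (0 : ℚ) < m := mod_cast Nat.pos_of_ne_zero hm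
  linarith [sq_nonneg q]

theorem theorem2p8_general (m : ℕ) (hm : ¬ 4 ∣ m) :
    ((∃ r s : imagQuadField m, r ^ 2 + s ^ 2 = -1 ∧ r * s * (r ^ 2 - s ^ 2) ≠ 0) ↔
      ¬ m ≡ 7 [MOD 8]) ∧
    ((∃ t u : imagQuadField m, t ^ 2 + u ^ 2 = -2 ∧ t * u * (t ^ 2 - u ^ 2) ≠ 0) ↔
      ¬ m ≡ 7 [MOD 8]) := by
  have hm0 : m ≠ 0 := fun h ↦ hm (h ▸ dvd_zero 4)
  have hlevel : (∃ r s : imagQuadField m, r ^ 2 + s ^ 2 = -1) ↔ ¬ m ≡ 7 [MOD 8] :=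
    (exists_sq_add_sq_eq_neg_one_adjoin_iff two_ne_zero
      (by simpa using imagQuadField_gen_sq m) (I_mul_sqrt_notMem_range_algebraMap hm0)).trans
      (exists_rat_three_squares_iff hm)
  have htwo : (-2 : imagQuadField m) = 2 * -1 := by norm_num
  constructor
  · rw [exists_sq_add_sq_eq_and_ne_zero_iff (neg_ne_zero.mpr one_ne_zero), hlevel]
  · rw [exists_sq_add_sq_eq_and_ne_zero_iff (neg_ne_zero.mpr two_ne_zero), htwo,
      exists_sq_add_sq_eq_two_mul_iff two_ne_zero, hlevel]

theorem theorem2p8 (m : ℕ) (hm_pos : 0 < m) (hm : Squarefree m) :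
    ((∃ r s : imagQuadField m, r ^ 2 + s ^ 2 = -1 ∧ r * s * (r ^ 2 - s ^ 2) ≠ 0) ↔
      ¬ m ≡ 7 [MOD 8]) ∧
    ((∃ t u : imagQuadField m, t ^ 2 + u ^ 2 = -2 ∧ t * u * (t ^ 2 - u ^ 2) ≠ 0) ↔
      ¬ m ≡ 7 [MOD 8]) :=
  theorem2p8_general m fun h ↦ absurd (Nat.isUnit_iff.mp (hm 2 h)) (by norm_num)
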